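/- Let $M\ge 0$, $\omega\in\mathbb R$, $q>\omega$, $0<\varepsilon<1$, $C>0$, $\tau\ge 0$, $0<\delta\le\pi/2$ and $L\in\mathbb R$. Then there is a constant $C''>0$, depending only on $M,\omega,q,\varepsilon,C,\tau,\delta,L$, such that the following holds. For $N\in\mathbb N^+$ let $\mathcal X_N$ and $X_N$ be complex Banach spaces, let $P_N:\mathcal X_N\to X_N$ be bounded linear operators with $\|P_N\|\le K$ for some $K>0$, let $A_N$ generate a strongly continuous semigroup $T_N$ on $X_N$, and let $\mathcal A_N$ generate an analytic semigroup $S_N$ on $\mathcal X_N$, with $$\|T_N(t)\|\le Me^{\omega t},\qquad \|S_N(t)\|\le Me^{\omega t}\qquad (t\ge 0).$$ Let $Y_N=D(\mathcal A_N)$ with the norm $\|f\|_{Y_N}=\|(qI-\mathcal A_N)f\|$, and $Z_N=D((qI-\mathcal A_N)^{\varepsilon})$ with the norm $\|f\|_{Z_N}=\|(qI-\mathcal A_N)^{\varepsilon}f\|$, where $(qI-\mathcal A_N)^{\varepsilon}$ is the inverse of $(qI-\mathcal A_N)^{-\varepsilon}=\frac1{\Gamma(\varepsilon)}\int_0^\infty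 r^{\varepsilon-1}e^{-qr}S_N(r)\,dr$. Suppose that $P_NY_N\subset D(A_N)$ and that, for some $p\ge 0$, $$\|A_NP_NS_N(t)f-P_N\mathcal A_NS_N(t)f\|_{X_N}\le C\,\frac{\|S_N(t)f\|_{Y_N}}{N^p}\qquad\text{for all } N\in\mathbb N^+,\ f\in Y_N,\ 0\le t\le\tau .$$ Then for every $N$ for which $S_N$ is analytic of type $(\delta,L)$, that is, $S_N$ extends holomorphically to the sector $\{z\ne 0:|\arg z|<\delta\}$ and the extension has norm at most $L$ on the part of the sector with $|z|\le 1$, $$\|T_N(t)P_Nf-P_NS_N(t)f\|_{X_N}\le C''\,\frac{\|f\|_{Z_N}}{N^p}\qquad\text{for all } f\in Z_N,\ 0\le t\le\tau .$$ (Every analytic semigroup is of type $(\delta,L)$ for some $\delta\in(0,\pi/2]$ and some $L$. If all $S_N$ are of one common type, then $C''$ does not depend on $N$.) -/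

import Mathlib

open Set Filter Topology MeasureTheory

noncomputable section

namespace TrotterKato

variable {E : Type*} [NormedAddCommGroup E] [NormedSpace ℂ E]

/-- A strongly continuous one-parameter semigroup of bounded operators on `E`.
Only the values at times `t ≥ 0` are meaningful. -/
structure IsC0Semigroup (S : ℝ → E →L[ℂ] E) : Prop where
  map_zero : S 0 = 1
  map_add : ∀ s t : ℝ, 0 ≤ s → 0 ≤ t → S (s + t) = S s * S t
  tendsto_zero : ∀ x : E, Tendsto (fun t : ℝ => S t x) (𝓝[>] 0) (𝓝 x)

/-- The (unbounded) operator `A` generates the strongly continuous semigroup `S`: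
`x ∈ D(A)` and `A x = y` if and only if `(S(t) x - x) / t → y` as `t ↓ 0`. -/
structure Generates (A : E →ₗ.[ℂ] E) (S : ℝ → E →L[ℂ] E) : Prop where
  isC0Semigroup : IsC0Semigroup S
  mem_graph_iff : ∀ x y : E, (x, y) ∈ A.graph ↔
    Tendsto (fun t : ℝ => ((t : ℂ)⁻¹) • (S t x - x)) (𝓝[>] 0) (𝓝 y)

/-- The open sector of half-angle `δ` around the positive real axis. -/
def sector (δ : ℝ) : Set ℂ := {z | z ≠ 0 ∧ |z.arg| < δ}

/-- The family `S` has a holomorphic extension to the sector of half-angle `δ` that is bounded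
by `L` on the part of the sector inside the closed unit disc. -/
def IsAnalyticOfType (S : ℝ → E →L[ℂ] E) (δ L : ℝ) : Prop :=
  ∃ F : ℂ → E →L[ℂ] E,
    DifferentiableOn ℂ F (sector δ) ∧
    (∀ t : ℝ, 0 < t → F (t : ℂ) = S t) ∧
    ∀ z ∈ sector δ, ‖z‖ ≤ 1 → ‖F z‖ ≤ L

/-- Analytic (holomorphic) semigroup: a strongly continuous semigroup with a holomorphic
extension to some sector that is bounded near the origin. (The semigroup law and the strong
continuity at `0` of the extension on smaller sectors are then automatic.) -/
def IsAnalyticSemigroup (S : ℝ → E →L[ℂ] E) : Prop :=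
  IsC0Semigroup S ∧ ∃ δ : ℝ, 0 < δ ∧ δ ≤ Real.pi / 2 ∧ ∃ L : ℝ, IsAnalyticOfType S δ L

/-- The negative fractional power `(q - A)^(-ε)`, where `A` is the generator of `S`, given by
`Γ(ε)⁻¹ ∫₀^∞ r^(ε-1) e^(-q r) S(r) g dr`; the integral converges absolutely when `ε > 0` and `q`
exceeds the growth bound of `S`. -/
def negFracPow (S : ℝ → E →L[ℂ] E) (q ε : ℝ) (g : E) : E :=
  (((Real.Gamma ε)⁻¹ : ℝ) : ℂ) •
    ∫ r in Ioi (0 : ℝ), ((r ^ (ε - 1) * Real.exp (-q * r) : ℝ) : ℂ) • S r g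

/-- The domain of the fractional power `(q - A)^ε`, i.e. the range of `(q - A)^(-ε)`. -/
def fracDomain (S : ℝ → E →L[ℂ] E) (q ε : ℝ) : Set E := range (negFracPow S q ε)

/-- The fractional power `(q - A)^ε` on its domain: the inverse of `(q - A)^(-ε)`
(values outside `fracDomain S q ε` are meaningless). -/
def fracPow (S : ℝ → E →L[ℂ] E) (q ε : ℝ) : E → E := Function.invFun (negFracPow S q ε)

/-- The norm `‖f‖_Z = ‖(q - A)^ε f‖` of `Z = D((q - A)^ε)`. -/
def fracNorm (S : ℝ → E →L[ℂ] E) (q ε : ℝ) (f : E) : ℝ := ‖fracPow S q ε f‖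

/-- The norm `‖f‖_Y = ‖(q - A) f‖` of `Y = D(q - A) = D(A)`. -/
def graphNorm (A : E →ₗ.[ℂ] E) (q : ℝ) (f : A.domain) : ℝ := ‖(q : ℂ) • (f : E) - A f‖

end TrotterKato

end

namespace TrotterKato

variable {E : Type*} [NormedAddCommGroup E] [NormedSpace ℂ E]
variable {F : Type*} [NormedAddCommGroup F] [NormedSpace ℂ F]
variable {S : ℝ → E →L[ℂ] E} {M ω : ℝ}

/-! Let g = (q - 𝒜)^ε f. Then f is the weighted integral of S(r)g over r > 0, and the bounded error
operator T(t)P - P S(t) passes under it, so it suffices to bound the error at each S(r)g.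

Differentiating s ↦ T(t-s) P S(s) S(r)g and using consistency bounds this error by C N^(-p) times
the integral over 0 ≤ s ≤ t of M e^{ω(t-s)} ‖S(s+r)g‖_Y (`norm_intertwine_sub_le`). Cauchy's
estimate for the holomorphic extension gives ‖S(u)g‖_Y ≤ e^{ωu}(c₁/u + c₂)‖g‖
(`graphNorm_le_of_analytic`), so the integral contributes c₁ log((t+r)/r) + c₂t.

The logarithm blows up as r → 0, but more slowly than r^(-ε/2) (`log_one_add_div_le`). Against the
weight r^(ε-1) e^{-qr} it remains integrable: this is the gain from ε > 0. -/

/-! ### Strongly continuous semigroups and their generators. -/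

theorem IsC0Semigroup.tendsto_abs (hS : IsC0Semigroup S) (x : E) :
    Tendsto (fun h : ℝ => S |h| x) (𝓝 0) (𝓝 x) := by
  have h1 : ContinuousWithinAt (fun t : ℝ => S t x) (Ioi 0) 0 := by
    have := hS.tendsto_zero x
    simpa [ContinuousWithinAt, hS.map_zero] using this
  have h2 : Tendsto (fun t : ℝ => S t x) (𝓝[≥] 0) (𝓝 x) := by
    have := continuousWithinAt_Ioi_iff_Ici.1 h1
    simpa [ContinuousWithinAt, hS.map_zero] using this
  refine h2.comp (tendsto_nhdsWithin_iff.2 ⟨?_, Eventually.of_forall fun h => abs_nonneg h⟩)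
  simpa using (continuous_abs (G := ℝ)).tendsto 0

theorem IsC0Semigroup.apply_add (hS : IsC0Semigroup S) {s t : ℝ} (hs : 0 ≤ s) (ht : 0 ≤ t)
    (x : E) : S (s + t) x = S s (S t x) := by
  rw [hS.map_add s t hs ht]; rfl

/-- Joint continuity of `(t, x) ↦ S t x` on `[0, ∞) × E` for an exponentially bounded
semigroup. -/
theorem IsC0Semigroup.tendsto_apply (hS : IsC0Semigroup S)
    (hb : ∀ t : ℝ, 0 ≤ t → ‖S t‖ ≤ M * Real.exp (ω * t)) {ι : Type*} {l : Filter ι}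
    {a : ι → ℝ} {y : ι → E} {a₀ : ℝ} {y₀ : E} (ha₀ : 0 ≤ a₀) (ha : Tendsto a l (𝓝 a₀))
    (hpos : ∀ᶠ i in l, 0 ≤ a i) (hy : Tendsto y l (𝓝 y₀)) :
    Tendsto (fun i => S (a i) (y i)) l (𝓝 (S a₀ y₀)) := by
  have hexp : Tendsto (fun i => M * Real.exp (ω * a i)) l (𝓝 (M * Real.exp (ω * a₀))) :=
    ((Real.continuous_exp.tendsto _).comp (ha.const_mul ω)).const_mul M
  have hsub : Tendsto (fun i => a i - a₀) l (𝓝 0) := by simpa using ha.sub_const a₀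
  have hx : Tendsto (fun i => ‖S |a i - a₀| y₀ - y₀‖) l (𝓝 0) := by
    have := (((hS.tendsto_abs y₀).comp hsub).sub_const y₀).norm
    simpa using this
  have hyn : Tendsto (fun i => ‖y i - y₀‖) l (𝓝 0) := by
    simpa using (hy.sub_const y₀).norm
  rw [tendsto_iff_norm_sub_tendsto_zero]
  have hlim : Tendsto (fun i => M * Real.exp (ω * a i) * ‖y i - y₀‖ +
      (M * Real.exp (ω * a i) + M * Real.exp (ω * a₀)) * ‖S |a i - a₀| y₀ - y₀‖) l (𝓝 0) := by
    simpa using (hexp.mul hyn).add ((hexp.add_const (M * Real.exp (ω * a₀))).mul hx)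
  refine squeeze_zero' (Eventually.of_forall fun i => norm_nonneg _) ?_ hlim
  filter_upwards [hpos] with i hi
  have e : S (a i) (y i) - S a₀ y₀ = S (a i) (y i - y₀) + (S (a i) y₀ - S a₀ y₀) := by
    rw [map_sub]; abel
  rw [e]
  refine (norm_add_le _ _).trans (add_le_add ((S (a i)).le_of_opNorm_le (hb _ hi) _) ?_)
  have n1 : 0 ≤ M * Real.exp (ω * a i) := (norm_nonneg _).trans (hb _ hi)
  have n2 : 0 ≤ M * Real.exp (ω * a₀) := (norm_nonneg _).trans (hb _ ha₀)
  -- The later time is the earlier one plus `|a i - a₀|`, so only strong continuity at 0 is needed,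
  -- on either side of `a₀`.
  rcases le_total (a i) a₀ with h | h
  · have e2 : S a₀ y₀ = S (a i) (S |a i - a₀| y₀) := by
      rw [← hS.apply_add hi (abs_nonneg _), abs_of_nonpos (by linarith)]
      congr 2; ring
    rw [e2, ← map_sub, norm_sub_rev (S |a i - a₀| y₀)]
    refine ((S (a i)).le_of_opNorm_le (hb _ hi) _).trans ?_
    exact mul_le_mul_of_nonneg_right (by linarith) (norm_nonneg _)
  · have e2 : S (a i) y₀ = S a₀ (S |a i - a₀| y₀) := by
      rw [← hS.apply_add ha₀ (abs_nonneg _), abs_of_nonneg (by linarith)]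
      congr 2; ring
    rw [e2, ← map_sub]
    refine ((S a₀).le_of_opNorm_le (hb _ ha₀) _).trans ?_
    exact mul_le_mul_of_nonneg_right (by linarith) (norm_nonneg _)

theorem IsC0Semigroup.continuousOn_orbit (hS : IsC0Semigroup S)
    (hb : ∀ t : ℝ, 0 ≤ t → ‖S t‖ ≤ M * Real.exp (ω * t)) (x : E) :
    ContinuousOn (fun t => S t x) (Ici 0) := fun _ ht =>
  hS.tendsto_apply hb ht (tendsto_id.mono_left nhdsWithin_le_nhds) self_mem_nhdsWithin
    tendsto_const_nhds

theorem Generates.mem_domain_of_tendsto {A : E →ₗ.[ℂ] E} (hA : Generates A S) {x y : E}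
    (h : Tendsto (fun t : ℝ => ((t : ℂ)⁻¹) • (S t x - x)) (𝓝[>] 0) (𝓝 y)) :
    ∃ hx : x ∈ A.domain, A ⟨x, hx⟩ = y := by
  have := (hA.mem_graph_iff x y).2 h
  obtain ⟨z, hz, hzy⟩ := (LinearPMap.mem_graph_iff A).1 this
  dsimp only at hz hzy
  subst hz
  exact ⟨z.2, hzy⟩

theorem Generates.tendsto {A : E →ₗ.[ℂ] E} (hA : Generates A S) {x : E} (hx : x ∈ A.domain) :
    Tendsto (fun t : ℝ => ((t : ℂ)⁻¹) • (S t x - x)) (𝓝[>] 0) (𝓝 (A ⟨x, hx⟩)) :=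
  (hA.mem_graph_iff _ _).1 (A.mem_graph ⟨x, hx⟩)

theorem Generates.apply_semigroup {A : E →ₗ.[ℂ] E} (hA : Generates A S) {x : E}
    (hx : x ∈ A.domain) {s : ℝ} (hs : 0 ≤ s) :
    ∃ h : S s x ∈ A.domain, A ⟨S s x, h⟩ = S s (A ⟨x, hx⟩) := by
  refine hA.mem_domain_of_tendsto ?_
  refine (((S s).continuous.tendsto _).comp (hA.tendsto hx)).congr' ?_
  filter_upwards [self_mem_nhdsWithin] with t ht
  have ht : 0 ≤ t := le_of_lt ht
  simp only [Function.comp, map_smul, map_sub, ← hA.isC0Semigroup.apply_add ht hs,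
    ← hA.isC0Semigroup.apply_add hs ht, add_comm]

/-! ### Variation of constants. -/

/-- The variation of constants estimate comparing `T t ∘ P` with `P ∘ S t` along an orbit that
stays in the domain of the generator of `S`. -/
theorem norm_intertwine_sub_le {𝒜 : E →ₗ.[ℂ] E} {A : F →ₗ.[ℂ] F} {T : ℝ → F →L[ℂ] F}
    (P : E →L[ℂ] F) (h𝒜 : Generates 𝒜 S) (hA : Generates A T)
    (hSb : ∀ t : ℝ, 0 ≤ t → ‖S t‖ ≤ M * Real.exp (ω * t))
    (hTb : ∀ t : ℝ, 0 ≤ t → ‖T t‖ ≤ M * Real.exp (ω * t))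
    {f : E} {t : ℝ} (ht : 0 ≤ t)
    (hdom : ∀ s, 0 ≤ s → S s f ∈ 𝒜.domain) (hP : ∀ x ∈ 𝒜.domain, P x ∈ A.domain)
    {B B' : ℝ → ℝ} (hB0 : 0 ≤ B 0) (hB : ∀ s, 0 ≤ s → HasDerivAt B (B' s) s)
    (hbound : ∀ s (hs : 0 ≤ s), s < t →
      M * Real.exp (ω * (t - s)) *
        ‖A ⟨P (S s f), hP _ (hdom s hs)⟩ - P (𝒜 ⟨S s f, hdom s hs⟩)‖ ≤ B' s) :
    ‖T t (P f) - P (S t f)‖ ≤ B t := by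
  have hS0 := h𝒜.isC0Semigroup
  have hT0 := hA.isC0Semigroup
  -- The interpolating path, shifted to start at 0; it ends at P S(t)f - T(t)Pf.
  let φ : ℝ → F := fun s => T (t - s) (P (S s f)) - T t (P f)
  let D : ℝ → F := fun s => if hs : 0 ≤ s then
    T (t - s) (P (𝒜 ⟨S s f, hdom s hs⟩) - A ⟨P (S s f), hP _ (hdom s hs)⟩) else 0
  have hcont : ContinuousOn φ (Icc 0 t) := by
    intro s hs
    refine Tendsto.sub_const (hT0.tendsto_apply hTb (by linarith [hs.2]) ?_ ?_ ?_) _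
    · exact ((continuous_const.sub continuous_id).tendsto s).mono_left nhdsWithin_le_nhds
    · filter_upwards [self_mem_nhdsWithin] with u hu
      simpa using hu.2
    · exact (P.continuous.tendsto _).comp
        ((hS0.continuousOn_orbit hSb f s hs.1).mono_left (nhdsWithin_mono _ Icc_subset_Ici_self))
  have hder : ∀ s ∈ Ico 0 t, HasDerivWithinAt φ (D s) (Ici s) s := by
    intro s hs
    rw [hasDerivWithinAt_iff_tendsto_slope, Ici_sdiff_left]
    have hsub : Tendsto (fun u : ℝ => u - s) (𝓝[>] s) (𝓝[>] 0) := by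
      refine tendsto_nhdsWithin_iff.2 ⟨?_, ?_⟩
      · have : Tendsto (fun u : ℝ => u - s) (𝓝 s) (𝓝 (s - s)) :=
          tendsto_id.sub_const s
        rw [sub_self] at this
        exact this.mono_left nhdsWithin_le_nhds
      · filter_upwards [self_mem_nhdsWithin] with u hu
        simpa using hu
    have h1 := (P.continuous.tendsto _).comp ((h𝒜.tendsto (hdom s hs.1)).comp hsub)
    have h2 := (hA.tendsto (hP _ (hdom s hs.1))).comp hsub
    have h3 := hT0.tendsto_apply hTb (a := fun u => t - u) (a₀ := t - s) (l := 𝓝[>] s)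
      (by linarith [hs.2])
      (((continuous_const.sub continuous_id).tendsto s).mono_left nhdsWithin_le_nhds)
      (by
        filter_upwards [Ioo_mem_nhdsGT hs.2] with u hu
        linarith [hu.2]) (h1.sub h2)
    have hD : D s = T (t - s)
        (P (𝒜 ⟨S s f, hdom s hs.1⟩) - A ⟨P (S s f), hP _ (hdom s hs.1)⟩) := by
      simp only [D, dif_pos hs.1]
    rw [hD]
    -- Since T(t-s) = T(t-u) T(u-s), the slope of `φ` is T(t-u) applied to a difference of two
    -- generator quotients at time u - s.
    refine h3.congr' ?_
    filter_upwards [Ioo_mem_nhdsGT hs.2] with u hu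
    have hu1 : 0 ≤ u - s := by linarith [hu.1]
    have e1 : S (u - s) (S s f) = S u f := by
      rw [← hS0.apply_add hu1 hs.1]; congr 2; ring
    have e2 : T (t - u) (T (u - s) (P (S s f))) = T (t - s) (P (S s f)) := by
      rw [← hT0.apply_add (by linarith [hu.2]) hu1]; congr 2; ring
    simp only [Function.comp, slope, φ, vsub_eq_sub, map_smul, map_sub, ← smul_sub, e1, e2]
    rw [← Complex.ofReal_inv, Complex.coe_smul]
    congr 1
    abel
  -- Comparison with the majorant `B` replaces integration, so no integrability of `D` is required.
  have key := image_norm_le_of_norm_deriv_right_le_deriv_boundary' (f := φ) (f' := D) (a := 0)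
    (b := t) hcont hder (B := B) (B' := B')
    (by simpa [φ, hS0.map_zero] using hB0)
    (fun s hs => (hB s hs.1).continuousAt.continuousWithinAt)
    (fun s hs => (hB s hs.1).hasDerivWithinAt)
    (fun s hs => by
      simp only [D, dif_pos hs.1]
      refine le_trans ((T (t - s)).le_of_opNorm_le (hTb _ (by linarith [hs.2])) _) ?_
      rw [norm_sub_rev]
      exact hbound s hs.1 hs.2) (right_mem_Icc.2 ht)
  simpa [φ, hT0.map_zero, norm_sub_rev] using key

/-! ### Smoothing by analytic semigroups. -/

/-- The sector is open and invariant under positive scaling, so a disc around 1 scales to every u.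
The radius proportional to u produces the 1/u in Cauchy's estimate. -/
theorem exists_closedBall_subset_sector {δ : ℝ} (hδ : 0 < δ) :
    ∃ ρ : ℝ, 0 < ρ ∧ ρ ≤ 1 ∧ ∀ u : ℝ, 0 < u → Metric.closedBall (u : ℂ) (u * ρ) ⊆ sector δ := by
  have h1 : sector δ ∈ 𝓝 (1 : ℂ) := by
    have ha : ContinuousAt Complex.arg 1 := Complex.continuousAt_arg (by simp)
    have hlt : ∀ᶠ z in 𝓝 (1 : ℂ), |z.arg| < δ :=
      ha.abs.eventually_lt continuousAt_const (by simpa using hδ)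
    filter_upwards [hlt, isOpen_ne.mem_nhds (one_ne_zero : (1 : ℂ) ≠ 0)] with z hz hz0
    exact ⟨hz0, hz⟩
  obtain ⟨ρ, hρ, hsub⟩ := Metric.nhds_basis_closedBall.mem_iff.1 h1
  refine ⟨min ρ 1, lt_min hρ one_pos, min_le_right _ _, fun u hu z hz => ?_⟩
  have hu' : (u : ℂ) ≠ 0 := by exact_mod_cast hu.ne'
  have hw : z / u ∈ sector δ := by
    apply hsub
    rw [mem_closedBall_iff_norm] at hz ⊢
    have : z / u - 1 = (z - u) / u := by field_simp
    rw [this, norm_div, Complex.norm_real, Real.norm_of_nonneg hu.le, div_le_iff₀ hu]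
    exact hz.trans (by rw [mul_comm]; exact mul_le_mul_of_nonneg_right (min_le_left _ _) hu.le)
  have hz' : z = (u : ℂ) * (z / u) := by field_simp
  rw [hz']
  refine ⟨mul_ne_zero hu' hw.1, ?_⟩
  rw [Complex.arg_real_mul _ hu]
  exact hw.2

/-- A semigroup of analytic type `(δ, L)` maps into the domain of its generator, with the
Cauchy bound `L / (ρ u)` for small times `u`. -/
theorem Generates.norm_apply_le_of_analytic_small {A : E →ₗ.[ℂ] E} (hA : Generates A S)
    {δ L ρ : ℝ} (hρ : 0 < ρ) (hρ1 : ρ ≤ 1)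
    (hball : ∀ u : ℝ, 0 < u → Metric.closedBall (u : ℂ) (u * ρ) ⊆ sector δ)
    (han : IsAnalyticOfType S δ L) {u : ℝ} (hu : 0 < u) (hu1 : u ≤ 1 / 2) (g : E) :
    ∃ h : S u g ∈ A.domain, ‖A ⟨S u g, h⟩‖ ≤ L / (u * ρ) * ‖g‖ := by
  obtain ⟨F, hF, hFS, hFL⟩ := han
  have hr : 0 < u * ρ := mul_pos hu hρ
  have hdb : DifferentiableOn ℂ F (Metric.closedBall (u : ℂ) (u * ρ)) := hF.mono (hball u hu)
  have hat : HasDerivAt F (deriv F u) u :=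
    ((hdb _ (Metric.mem_closedBall_self hr.le)).differentiableAt
      (Metric.closedBall_mem_nhds _ hr)).hasDerivAt
  have hdc : DiffContOnCl ℂ (fun z => F z g) (Metric.ball (u : ℂ) (u * ρ)) := by
    apply DifferentiableOn.diffContOnCl
    rw [closure_ball _ hr.ne']
    exact hdb.clm_apply (differentiableOn_const g)
  have hatg : HasDerivAt (fun z => F z g) (deriv F u g) u := by
    simpa using hat.clm_apply (hasDerivAt_const (u : ℂ) g)
  have hest : ‖deriv F u g‖ ≤ L / (u * ρ) * ‖g‖ := by
    rw [← hatg.deriv, div_mul_eq_mul_div]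
    refine Complex.norm_deriv_le_of_forall_mem_sphere_norm_le hr hdc fun z hz => ?_
    have hz' := Metric.sphere_subset_closedBall hz
    refine (F z).le_of_opNorm_le (hFL z (hball u hu hz') ?_) g
    -- Since u ≤ 1/2 and ρ ≤ 1, the circle lies in the unit disc, where `L` bounds the extension.
    have h1 : ‖z - u‖ ≤ u * ρ := mem_closedBall_iff_norm.1 hz'
    have h2 : ‖z‖ ≤ ‖z - u‖ + ‖(u : ℂ)‖ := by simpa using norm_add_le (z - u) u
    rw [Complex.norm_real, Real.norm_of_nonneg hu.le] at h2
    nlinarith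
  have hS' : HasDerivAt (fun t : ℝ => S t g) (deriv F u g) u := by
    have hc : HasDerivAt (fun t : ℝ => F t g) (deriv F u g) u := by
      simpa [Function.comp_def] using hatg.scomp u Complex.ofRealCLM.hasDerivAt
    refine hc.congr_of_eventuallyEq ?_
    filter_upwards [lt_mem_nhds hu] with t ht
    rw [hFS t ht]
  obtain ⟨h, he⟩ := hA.mem_domain_of_tendsto (x := S u g) (y := deriv F u g) (by
    refine hS'.tendsto_slope_zero_right.congr' ?_
    filter_upwards [self_mem_nhdsWithin] with t ht
    rw [add_comm, hA.isC0Semigroup.apply_add (le_of_lt ht) hu.le, ← Complex.ofReal_inv,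
      Complex.coe_smul])
  exact ⟨h, he ▸ hest⟩

/-- Cauchy's estimate covers u ≤ 1/2; beyond that, S(u) = S(u - 1/2) S(1/2) and the growth bound
take over. The factor e^{|ω|} pays for writing both cases with e^{ωu} in front. -/
theorem Generates.graphNorm_le_of_analytic {A : E →ₗ.[ℂ] E} (hA : Generates A S)
    (hM : 0 ≤ M) (hSb : ∀ t : ℝ, 0 ≤ t → ‖S t‖ ≤ M * Real.exp (ω * t))
    {δ L ρ : ℝ} (q : ℝ) (hρ : 0 < ρ) (hρ1 : ρ ≤ 1)
    (hball : ∀ u : ℝ, 0 < u → Metric.closedBall (u : ℂ) (u * ρ) ⊆ sector δ)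
    (han : IsAnalyticOfType S δ L) {u : ℝ} (hu : 0 < u) (g : E) :
    ∃ h : S u g ∈ A.domain, graphNorm A q ⟨S u g, h⟩ ≤
      Real.exp (ω * u) * ((Real.exp |ω| * |L| / ρ) / u +
        (M * Real.exp |ω| * (2 * |L| / ρ) + |q| * M)) * ‖g‖ := by
  have hE : 0 < Real.exp (ω * u) := Real.exp_pos _
  have main : ∃ h : S u g ∈ A.domain, ‖A ⟨S u g, h⟩‖ ≤
      Real.exp (ω * u) * ((Real.exp |ω| * |L| / ρ) / u +
        M * Real.exp |ω| * (2 * |L| / ρ)) * ‖g‖ := by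
    rcases le_total u (1 / 2) with h2 | h2
    · obtain ⟨h, hn⟩ := hA.norm_apply_le_of_analytic_small hρ hρ1 hball han hu h2 g
      refine ⟨h, hn.trans (mul_le_mul_of_nonneg_right ?_ (norm_nonneg _))⟩
      have e1 : 1 ≤ Real.exp (ω * u) * Real.exp |ω| := by
        rw [← Real.exp_add]
        apply Real.one_le_exp
        nlinarith [neg_abs_le ω, abs_nonneg ω]
      have e2 : L / (u * ρ) ≤ |L| / (u * ρ) :=
        div_le_div_of_nonneg_right (le_abs_self L) (by positivity)
      have e3 : 0 ≤ |L| / (u * ρ) := by positivity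
      have e4 : 0 ≤ Real.exp (ω * u) * (M * Real.exp |ω| * (2 * |L| / ρ)) := by positivity
      have e5 : Real.exp (ω * u) * ((Real.exp |ω| * |L| / ρ) / u) =
          (Real.exp (ω * u) * Real.exp |ω|) * (|L| / (u * ρ)) := by
        field_simp
      rw [mul_add, e5]
      nlinarith
    · obtain ⟨h, hn⟩ :=
        hA.norm_apply_le_of_analytic_small hρ hρ1 hball han (by norm_num) le_rfl g
      obtain ⟨h', he⟩ := hA.apply_semigroup h (s := u - 1 / 2) (by linarith)
      have hSe : S (u - 1 / 2) (S (1 / 2) g) = S u g := by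
        rw [← hA.isC0Semigroup.apply_add (by linarith) (by norm_num)]; congr 2; ring
      have hn' := ((S (u - 1 / 2)).le_of_opNorm_le (hSb _ (by linarith)) _).trans
        (mul_le_mul_of_nonneg_left hn (by positivity))
      rw [← he] at hn'
      simp only [hSe] at h' hn'
      refine ⟨h', hn'.trans ?_⟩
      rw [← mul_assoc]
      refine mul_le_mul_of_nonneg_right ?_ (norm_nonneg _)
      have e1 : Real.exp (ω * (u - 1 / 2)) ≤ Real.exp (ω * u) * Real.exp |ω| := by
        rw [← Real.exp_add]
        apply Real.exp_le_exp.2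
        nlinarith [neg_abs_le ω, abs_nonneg ω]
      have e2 : L / (1 / 2 * ρ) ≤ 2 * |L| / ρ := by
        rw [show L / (1 / 2 * ρ) = 2 * L / ρ by field_simp]
        exact div_le_div_of_nonneg_right (by linarith [le_abs_self L]) hρ.le
      have e3 : 0 ≤ Real.exp (ω * u) * ((Real.exp |ω| * |L| / ρ) / u) := by positivity
      calc M * Real.exp (ω * (u - 1 / 2)) * (L / (1 / 2 * ρ))
          ≤ M * (Real.exp (ω * u) * Real.exp |ω|) * (2 * |L| / ρ) :=
            (mul_le_mul_of_nonneg_left e2 (by positivity)).trans (by gcongr)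
        _ ≤ _ := by rw [mul_add]; linarith
  obtain ⟨h, hn⟩ := main
  refine ⟨h, ?_⟩
  have hq : ‖(q : ℂ) • S u g‖ ≤ |q| * (M * Real.exp (ω * u) * ‖g‖) := by
    rw [norm_smul, Complex.norm_real, Real.norm_eq_abs]
    exact mul_le_mul_of_nonneg_left ((S u).le_of_opNorm_le (hSb u hu.le) g) (abs_nonneg q)
  calc graphNorm A q ⟨S u g, h⟩ ≤ ‖(q : ℂ) • S u g‖ + ‖A ⟨S u g, h⟩‖ := norm_sub_le _ _
    _ ≤ _ := add_le_add hq hn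
    _ = _ := by ring

/-! ### Integrals against the fractional power weight. -/

theorem integrableOn_rpow_mul_exp {a κ : ℝ} (ha : 0 < a) (hκ : 0 < κ) :
    IntegrableOn (fun r : ℝ => r ^ (a - 1) * Real.exp (-κ * r)) (Ioi 0) := by
  have := integrableOn_rpow_mul_exp_neg_mul_rpow (p := 1) (s := a - 1) (b := κ) (by linarith)
    one_pos hκ
  simpa using this

/-- The bound log x ≤ x^a / a at x = 1 + t/r, then subadditivity of x ↦ x^a for a ≤ 1. -/
theorem log_one_add_div_le {a t r : ℝ} (ha : 0 < a) (ha1 : a ≤ 1) (ht : 0 ≤ t) (hr : 0 < r) :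
    Real.log (t + r) - Real.log r ≤ (1 + t ^ a * r ^ (-a)) / a := by
  rw [← Real.log_div (by linarith) hr.ne', add_div, div_self hr.ne', add_comm]
  have h0 : 0 ≤ t / r := by positivity
  refine (Real.log_le_rpow_div (by linarith) ha).trans ?_
  gcongr
  refine (Real.rpow_add_le_add_rpow zero_le_one h0 ha.le ha1).trans ?_
  rw [Real.one_rpow, Real.div_rpow ht hr.le, Real.rpow_neg hr.le, div_eq_mul_inv]

theorem IsC0Semigroup.integrableOn_weight_smul (hS : IsC0Semigroup S)
    (hSb : ∀ t : ℝ, 0 ≤ t → ‖S t‖ ≤ M * Real.exp (ω * t)) {q ε : ℝ} (hq : ω < q) (hε : 0 < ε)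
    (g : E) :
    IntegrableOn (fun r : ℝ => ((r ^ (ε - 1) * Real.exp (-q * r) : ℝ) : ℂ) • S r g) (Ioi 0) := by
  have hdom := (integrableOn_rpow_mul_exp hε (sub_pos.2 hq)).mul_const (M * ‖g‖)
  refine Integrable.mono' hdom ?_ ?_
  · refine ContinuousOn.aestronglyMeasurable ?_ measurableSet_Ioi
    refine ContinuousOn.smul ?_ ((hS.continuousOn_orbit hSb g).mono Ioi_subset_Ici_self)
    refine Complex.continuous_ofReal.comp_continuousOn (ContinuousOn.mul ?_ (by fun_prop))
    exact fun r hr => (Real.continuousAt_rpow_const r _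
      (Or.inl (ne_of_gt hr))).continuousWithinAt
  · filter_upwards [ae_restrict_mem measurableSet_Ioi] with r hr
    have hr : 0 < r := hr
    have hw : 0 ≤ r ^ (ε - 1) * Real.exp (-q * r) := by positivity
    rw [norm_smul, Complex.norm_real, Real.norm_of_nonneg hw]
    refine (mul_le_mul_of_nonneg_left ((S r).le_of_opNorm_le (hSb r hr.le) g) hw).trans
      (le_of_eq ?_)
    have : Real.exp (-(q - ω) * r) = Real.exp (-q * r) * Real.exp (ω * r) := by
      rw [← Real.exp_add]; congr 1; ring
    rw [this]; ring

end TrotterKato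

/-! ### The error estimate. -/

theorem mainTheorem3
    -- the data on which the final constant may depend
    (M ω q ε C τ δ L : ℝ) (hM : 0 ≤ M) (hq : ω < q) (hε : 0 < ε) (hε1 : ε < 1)
    (hC : 0 < C) (hτ : 0 ≤ τ) (hδ : 0 < δ) (hδ1 : δ ≤ Real.pi / 2) :
    ∃ C'' : ℝ, 0 < C'' ∧
      ∀ (𝒳 X : ℕ+ → Type*)
        [∀ n, NormedAddCommGroup (𝒳 n)] [∀ n, NormedSpace ℂ (𝒳 n)] [∀ n, CompleteSpace (𝒳 n)]
        [∀ n, NormedAddCommGroup (X n)] [∀ n, NormedSpace ℂ (X n)] [∀ n, CompleteSpace (X n)]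
        (P : ∀ n, 𝒳 n →L[ℂ] X n)
        (𝒜 : ∀ n, 𝒳 n →ₗ.[ℂ] 𝒳 n) (A : ∀ n, X n →ₗ.[ℂ] X n)
        (S : ∀ n, ℝ → 𝒳 n →L[ℂ] 𝒳 n) (T : ∀ n, ℝ → X n →L[ℂ] X n)
        (K p : ℝ),
        0 < K → 0 ≤ p →
        (∀ n, ‖P n‖ ≤ K) →
        (∀ n, TrotterKato.Generates (A n) (T n)) →
        (∀ n, TrotterKato.Generates (𝒜 n) (S n)) →
        (∀ n, TrotterKato.IsAnalyticSemigroup (S n)) →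
        -- stability of both families of semigroups
        (∀ n, ∀ t : ℝ, 0 ≤ t → ‖T n t‖ ≤ M * Real.exp (ω * t)) →
        (∀ n, ∀ t : ℝ, 0 ≤ t → ‖S n t‖ ≤ M * Real.exp (ω * t)) →
        -- `P_n` maps `Y_n = D(𝒜_n)` into `D(A_n)`
        (∀ n, ∀ f ∈ (𝒜 n).domain, P n f ∈ (A n).domain) →
        -- consistency of the generators along the orbits starting in `Y_n`
        (∀ n, ∀ f ∈ (𝒜 n).domain, ∀ t ∈ Icc (0 : ℝ) τ,
          ∀ (h𝒜 : S n t f ∈ (𝒜 n).domain) (hA : P n (S n t f) ∈ (A n).domain),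
            ‖A n ⟨P n (S n t f), hA⟩ - P n (𝒜 n ⟨S n t f, h𝒜⟩)‖ ≤
              C * TrotterKato.graphNorm (𝒜 n) q ⟨S n t f, h𝒜⟩ / (n : ℝ) ^ p) →
        -- the estimate on `Z_n = D((q - 𝒜_n)^ε)`; the constant sees the individual semigroup
        -- `S_n` only through its analyticity type `(δ, L)`
        ∀ n, TrotterKato.IsAnalyticOfType (S n) δ L →
          ∀ f ∈ TrotterKato.fracDomain (S n) q ε, ∀ t ∈ Icc (0 : ℝ) τ,
            ‖T n t (P n f) - P n (S n t f)‖ ≤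
              C'' * TrotterKato.fracNorm (S n) q ε f / (n : ℝ) ^ p := by
  obtain ⟨ρ, hρ, hρ1, hball⟩ := TrotterKato.exists_closedBall_subset_sector hδ
  set c₁ : ℝ := Real.exp |ω| * |L| / ρ with hc₁
  set c₂ : ℝ := M * Real.exp |ω| * (2 * |L| / ρ) + |q| * M with hc₂
  have hc₁0 : 0 ≤ c₁ := by positivity
  have hc₂0 : 0 ≤ c₂ := by positivity
  have hκ : 0 < q - ω := sub_pos.2 hq
  -- The weight times c₁ log((t+r)/r) + c₂t, bounded by `log_one_add_div_le` with a = ε/2, uniformly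
  -- in t ≤ τ. Half of the exponent is spent on the logarithm, and r^(ε/2-1) is still integrable at
  -- 0.
  set G : ℝ → ℝ := fun r =>
    (c₁ / (ε / 2) + c₂ * τ) * (r ^ (ε - 1) * Real.exp (-(q - ω) * r)) +
      c₁ * τ ^ (ε / 2) / (ε / 2) * (r ^ (ε / 2 - 1) * Real.exp (-(q - ω) * r)) with hG
  have hGint : IntegrableOn G (Ioi 0) :=
    ((TrotterKato.integrableOn_rpow_mul_exp hε hκ).const_mul _).add
      ((TrotterKato.integrableOn_rpow_mul_exp (half_pos hε) hκ).const_mul _)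
  have hG0 : 0 ≤ ∫ r in Ioi (0 : ℝ), G r := by
    refine setIntegral_nonneg measurableSet_Ioi fun r hr => ?_
    have hr : 0 < r := hr
    positivity
  have hΓ : 0 < Real.Gamma ε := Real.Gamma_pos_of_pos hε
  -- The `+ 1` only makes the constant strictly positive, as M may be 0.
  refine ⟨(Real.Gamma ε)⁻¹ * (M * Real.exp (|ω| * τ) * C * ∫ r in Ioi (0 : ℝ), G r) + 1,
    by positivity, ?_⟩
  intro 𝒳 X _ _ _ _ _ _ P 𝒜 A S T K p _ _ _ hAT h𝒜S _ hTb hSb hP hcons n han f hf t ht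
  have hN : 0 < (n : ℝ) ^ p := Real.rpow_pos_of_pos (by exact_mod_cast n.pos) p
  have hS0 := (h𝒜S n).isC0Semigroup
  obtain ⟨g, hg, hgf⟩ : ∃ g, TrotterKato.negFracPow (S n) q ε g = f ∧ TrotterKato.fracNorm (S n) q ε f = ‖g‖ :=
    ⟨TrotterKato.fracPow (S n) q ε f, Function.invFun_eq hf, rfl⟩
  -- Consistency at time 0 already holds on all of D(𝒜), so it applies to S(s+r)g even when s + r >
  -- τ.
  have hcons0 : ∀ x (hx : x ∈ (𝒜 n).domain),
      ‖A n ⟨P n x, hP n x hx⟩ - P n (𝒜 n ⟨x, hx⟩)‖ ≤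
        C * TrotterKato.graphNorm (𝒜 n) q ⟨x, hx⟩ / (n : ℝ) ^ p := by
    intro x hx
    have h0 : S n 0 x = x := by rw [hS0.map_zero]; rfl
    have := hcons n x hx 0 ⟨le_rfl, hτ⟩
    simp only [h0] at this
    exact this hx (hP n x hx)
  have hpt : ∀ r : ℝ, 0 < r → ‖T n t (P n (S n r g)) - P n (S n t (S n r g))‖ ≤
      M * Real.exp (ω * (t + r)) * C / (n : ℝ) ^ p * ‖g‖ *
        (c₁ * (Real.log (t + r) - Real.log r) + c₂ * t) := by
    intro r hr
    have hdom : ∀ s, 0 ≤ s → ∃ h : S n s (S n r g) ∈ (𝒜 n).domain,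
        TrotterKato.graphNorm (𝒜 n) q ⟨S n s (S n r g), h⟩ ≤
          Real.exp (ω * (s + r)) * (c₁ / (s + r) + c₂) * ‖g‖ := by
      intro s hs
      rw [← hS0.apply_add hs hr.le]
      exact (h𝒜S n).graphNorm_le_of_analytic hM (hSb n) q hρ hρ1 hball han (by linarith) g
    refine TrotterKato.norm_intertwine_sub_le (P n) (h𝒜S n) (hAT n) (hSb n) (hTb n) ht.1
      (fun s hs => (hdom s hs).1) (hP n)
      -- The primitive, vanishing at s = 0, of the smoothing bound c₁/(s+r) + c₂; the exponentials
      -- combine to e^{ω(t+r)}, independent of s.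
      (B := fun s => M * Real.exp (ω * (t + r)) * C / (n : ℝ) ^ p * ‖g‖ *
        (c₁ * (Real.log (s + r) - Real.log r) + c₂ * s))
      (B' := fun s => M * Real.exp (ω * (t + r)) * C / (n : ℝ) ^ p * ‖g‖ *
        (c₁ / (s + r) + c₂)) (by simp) ?_ ?_
    · intro s hs
      have h1 : HasDerivAt (fun s => Real.log (s + r)) (1 / (s + r)) s :=
        ((hasDerivAt_id s).add_const r).log (by simp only [id]; linarith)
      have h2 := (((h1.sub_const (Real.log r)).const_mul c₁).add
        ((hasDerivAt_id s).const_mul c₂)).const_mul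
          (M * Real.exp (ω * (t + r)) * C / (n : ℝ) ^ p * ‖g‖)
      simpa [div_eq_mul_inv] using h2
    · intro s hs _
      obtain ⟨h, hgn⟩ := hdom s hs
      have hexp : Real.exp (ω * (t + r)) = Real.exp (ω * (t - s)) * Real.exp (ω * (s + r)) := by
        rw [← Real.exp_add]; congr 1; ring
      calc M * Real.exp (ω * (t - s)) * ‖A n ⟨P n (S n s (S n r g)), hP n _ h⟩ -
              P n (𝒜 n ⟨S n s (S n r g), h⟩)‖
          ≤ M * Real.exp (ω * (t - s)) *
            (C * (Real.exp (ω * (s + r)) * (c₁ / (s + r) + c₂) * ‖g‖) / (n : ℝ) ^ p) := by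
            refine mul_le_mul_of_nonneg_left ((hcons0 _ h).trans ?_) (by positivity)
            gcongr
        _ = _ := by rw [hexp]; ring
  have hpt' : ∀ r : ℝ, 0 < r →
      ‖((r ^ (ε - 1) * Real.exp (-q * r) : ℝ) : ℂ) •
        (T n t (P n (S n r g)) - P n (S n t (S n r g)))‖ ≤
      M * Real.exp (|ω| * τ) * C / (n : ℝ) ^ p * ‖g‖ * G r := by
    intro r hr
    have hw : 0 ≤ r ^ (ε - 1) * Real.exp (-q * r) := by positivity
    rw [norm_smul, Complex.norm_real, Real.norm_of_nonneg hw]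
    have hlog := TrotterKato.log_one_add_div_le (half_pos hε) (by linarith) ht.1 hr
    have hωt : ω * t ≤ |ω| * τ :=
      mul_le_mul (le_abs_self ω) ht.2 ht.1 (abs_nonneg ω)
    have hexp : Real.exp (ω * (t + r)) ≤ Real.exp (|ω| * τ) * Real.exp (ω * r) := by
      rw [← Real.exp_add]; exact Real.exp_le_exp.2 (by linarith)
    have hpow : t ^ (ε / 2) ≤ τ ^ (ε / 2) := Real.rpow_le_rpow ht.1 ht.2 (by linarith)
    have hlogt : c₁ * (Real.log (t + r) - Real.log r) + c₂ * t ≤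
        c₁ * ((1 + τ ^ (ε / 2) * r ^ (-(ε / 2))) / (ε / 2)) + c₂ * τ := by
      refine add_le_add (mul_le_mul_of_nonneg_left (hlog.trans ?_) hc₁0)
        (mul_le_mul_of_nonneg_left ht.2 hc₂0)
      gcongr
    have hτ0 : 0 ≤ τ ^ (ε / 2) := Real.rpow_nonneg hτ _
    calc r ^ (ε - 1) * Real.exp (-q * r) *
          ‖T n t (P n (S n r g)) - P n (S n t (S n r g))‖
        ≤ r ^ (ε - 1) * Real.exp (-q * r) *
          (M * (Real.exp (|ω| * τ) * Real.exp (ω * r)) * C / (n : ℝ) ^ p * ‖g‖ *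
          (c₁ * ((1 + τ ^ (ε / 2) * r ^ (-(ε / 2))) / (ε / 2)) + c₂ * τ)) := by
          refine mul_le_mul_of_nonneg_left ((hpt r hr).trans ?_) hw
          refine (mul_le_mul_of_nonneg_left hlogt (by positivity)).trans ?_
          refine mul_le_mul_of_nonneg_right ?_ (by positivity)
          gcongr
      _ = _ := by
          have e1 : Real.exp (-(q - ω) * r) = Real.exp (-q * r) * Real.exp (ω * r) := by
            rw [← Real.exp_add]; congr 1; ring
          have e2 : r ^ (ε / 2 - 1) = r ^ (ε - 1) * r ^ (-(ε / 2)) := by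
            rw [← Real.rpow_add hr]; congr 1; ring
          simp only [hG, e1, e2]
          ring
  have hint := hS0.integrableOn_weight_smul (hSb n) hq hε g
  -- The error operator is bounded and linear, so it commutes with the Bochner integral defining f.
  have hEf : T n t (P n f) - P n (S n t f) = (((Real.Gamma ε)⁻¹ : ℝ) : ℂ) •
      ∫ r in Ioi (0 : ℝ), ((r ^ (ε - 1) * Real.exp (-q * r) : ℝ) : ℂ) •
        (T n t (P n (S n r g)) - P n (S n t (S n r g))) := by
    have := ((T n t ∘L P n) - (P n ∘L S n t)).integral_comp_comm hint
    simp only [map_smul, sub_apply, ContinuousLinearMap.comp_apply] at this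
    rw [this, ← hg, TrotterKato.negFracPow]
    simp only [map_smul, smul_sub]
  rw [hEf, hgf, norm_smul, Complex.norm_real, Real.norm_of_nonneg (by positivity)]
  have hI := norm_integral_le_of_norm_le
    (hGint.const_mul (M * Real.exp (|ω| * τ) * C / (n : ℝ) ^ p * ‖g‖))
    ((ae_restrict_mem measurableSet_Ioi).mono hpt')
  rw [integral_const_mul] at hI
  calc _ ≤ (Real.Gamma ε)⁻¹ * (M * Real.exp (|ω| * τ) * C / (n : ℝ) ^ p * ‖g‖ *
        ∫ r in Ioi (0 : ℝ), G r) := mul_le_mul_of_nonneg_left hI (by positivity)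
    _ = (Real.Gamma ε)⁻¹ * (M * Real.exp (|ω| * τ) * C * ∫ r in Ioi (0 : ℝ), G r) *
        ‖g‖ / (n : ℝ) ^ p := by ring
    _ ≤ _ := by
      gcongr
      linarith
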